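/- Let $0<\rho<1$, $\alpha\in\mathbb R$, let $h_0\le h_1\le h_2\le\cdots$ be non-negative integers, let $\xi\in\mathbb C$ (in the application to Lamé's equation $\xi=\mathrm{sn}^2(\cdot,\rho)$), and put $\eta=(1+\rho^2)\xi$, $z=-\rho^2\xi^2$. The Lamé function of type 2 and of the second kind is the series $$LS^R_{h_j}(\rho,\alpha;\xi)=\xi^{1/2}\sum_{n=0}^\infty c_n(\eta)\,z^n,\qquad c_0(\eta)=\sum_{i_0=0}^{h_0}P(i_0)\,\eta^{i_0},$$ $$c_n(\eta)=\sum_{i_0=0}^{h_0}B_0(i_0)P(i_0)\sum_{i_1=i_0}^{h_1}B_1(i_1)R_1(i_0,i_1)\cdots\sum_{i_{n-1}=i_{n-2}}^{h_{n-1}}B_{n-1}(i_{n-1})R_{n-1}(i_{n-2},i_{n-1})\sum_{i_n=i_{n-1}}^{h_n}R_n(i_{n-1},i_n)\,\eta^{i_n}\quad(n\ge1),$$ where, with $(x)_m$ the Pochhammer symbol, $$P(i)=\frac{(-h_0)_i(h_0+1)_i}{(3/2)_i(1)_i},\qquad B_k(i)=\frac{(i+2k+\frac\alpha2+1)(i+2k-\frac\alpha2+\frac12)}{(i+2k+\frac52)(i+2k+2)},$$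 $$R_k(j,i)=\frac{(-h_k)_i(h_k+4k+1)_i(2k+\frac32)_j(2k+1)_j}{(-h_k)_j(h_k+4k+1)_j(2k+\frac32)_i(2k+1)_i}.$$ (It is associated with the values $h=4(1+\rho^2)(h_j+2j+\frac12)^2$ of the parameter of Lamé's equation; $h$ enters the series only through the integers $h_j$.) For $l\ge1$ define the operator $T_l$ on functions $F$ of a complex variable by $$(T_lF)(w)=\int_0^1dt\,t^{2l-\frac12}\int_0^1du\,u^{2l-1}\,\frac1{2\pi i}\oint\frac{dv}{v}\left(\frac{v-1}{v}\,\frac1{1-w(1-t)(1-u)v}\right)^{h_l}\bigl(1-w(1-t)(1-u)v\bigr)^{-(4l+1)}(D_lF)(\tilde w),$$ $$\tilde w=\frac{v}{v-1}\,\frac{w\,t\,u}{1-w\,v(1-t)(1-u)},\qquad D_lF(y)=y^{-(2l-1+\frac\alpha2)}\,(y\partial_y)\,y^{\alpha+\frac12}\,(y\partial_y)\,y^{2l-\frac32-\frac\alpha2}F(y),$$ where all powers of $y$ are taken in one local branch (the result does not depend on it), and where the contour is any positively oriented circle about $0$, possibly depending on $l,w,t,u$, of radius $r>0$ with $r\,|w(1-t)(1-u)|<1$.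 Let $F_0(w)={}_2F_1(-h_0,h_0+1;\frac32;w)$ and $$I_n(\eta)=\bigl(T_nT_{n-1}\cdots T_1F_0\bigr)(\eta),$$ that is, the $n$-fold nested integral with $w_{n+1,n}=\eta$, $w_{l,n}=\tilde w(w_{l+1,n},t_l,u_l,v_l)$ for $l=n,\dots,1$, and innermost factor ${}_2F_1(-h_0,h_0+1;\frac32;w_{1,n})$. Then, for every admissible choice of the contours, the series and the integral representation agree term by term, $c_0(\eta)={}_2F_1(-h_0,h_0+1;\frac32;\eta)$ and $c_n(\eta)z^n=I_n(\eta)z^n$ for all $n\ge1$. Consequently $\sum_{n\ge0} c_n(\eta)z^n$ converges absolutely if and only if $\sum_{n\ge1}I_n(\eta)z^n$ does, and in that case $$LS^R_{h_j}(\rho,\alpha;\xi)=\xi^{1/2}\left\{{}_2F_1\!\left(-h_0,h_0+1;\tfrac32;\eta\right)+\sum_{n=1}^\infty I_n(\eta)\,z^n\right\}.$$ If the sequence $(h_j)$ is bounded and $|z|<1$, the series does converge absolutely. -/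

import Mathlib

noncomputable section

namespace LameTypeTwo

/-- The Pochhammer symbol `(x)_n = x (x+1) ⋯ (x+n-1)`. -/
def poch (x : ℂ) (n : ℕ) : ℂ := (ascPochhammer ℂ n).eval x

/-! ### The power series `LS^R` of the second kind -/

/-- `(i + 2k + α/2 + 1)(i + 2k - α/2 + 1/2) / ((i + 2k + 5/2)(i + 2k + 2))`. -/
def seriesFactor (α : ℝ) (k i : ℕ) : ℂ :=
  (((i : ℂ) + 2 * k + α / 2 + 1) * ((i : ℂ) + 2 * k - α / 2 + 1 / 2)) /
    (((i : ℂ) + 2 * k + 5 / 2) * ((i : ℂ) + 2 * k + 2))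

/-- The quotient of Pochhammer symbols in the `k`-th sum, `j = i_{k-1}` and `i = i_k`. -/
def seriesRatio (h : ℕ → ℕ) (k j i : ℕ) : ℂ :=
  (poch (-(h k : ℂ)) i * poch ((h k : ℂ) + 4 * k + 1) i *
      poch (2 * (k : ℂ) + 3 / 2) j * poch (2 * (k : ℂ) + 1) j) /
    (poch (-(h k : ℂ)) j * poch ((h k : ℂ) + 4 * k + 1) j *
      poch (2 * (k : ℂ) + 3 / 2) i * poch (2 * (k : ℂ) + 1) i)

/-- `(-h₀)_i (h₀+1)_i / ((3/2)_i (1)_i)`. -/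
def seriesInit (h : ℕ → ℕ) (i : ℕ) : ℂ :=
  (poch (-(h 0 : ℂ)) i * poch ((h 0 : ℂ) + 1) i) / (poch (3 / 2) i * poch 1 i)

/-- `seriesTail α h η m k j` is the nested sum over `i_k, …, i_{k+m}` (each running from the
preceding index to `h` of its own level), the preceding index `i_{k-1}` being `j`. -/
def seriesTail (α : ℝ) (h : ℕ → ℕ) (η : ℂ) : ℕ → ℕ → ℕ → ℂ
  | 0, k, j => ∑ i ∈ Finset.Icc j (h k), seriesRatio h k j i * η ^ i
  | m + 1, k, j => ∑ i ∈ Finset.Icc j (h k),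
      seriesFactor α k i * seriesRatio h k j i * seriesTail α h η m (k + 1) i

/-- The coefficient (a polynomial in `η`) of `z ^ n` in the series. -/
def seriesCoeff (α : ℝ) (h : ℕ → ℕ) (η : ℂ) : ℕ → ℂ
  | 0 => ∑ i ∈ Finset.Icc 0 (h 0), seriesInit h i * η ^ i
  | m + 1 => ∑ i ∈ Finset.Icc 0 (h 0),
      seriesFactor α 0 i * seriesInit h i * seriesTail α h η m 1 i

/-- `η = (1 + ρ²) ξ`. -/
def etaVar (ρ : ℝ) (ξ : ℂ) : ℂ := (1 + (ρ : ℂ) ^ 2) * ξ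

/-- `z = -ρ² ξ²`. -/
def zVar (ρ : ℝ) (ξ : ℂ) : ℂ := -(ρ : ℂ) ^ 2 * ξ ^ 2

/-- The `n`-th term of the series in braces that defines `LS^R`. -/
def seriesTerm (ρ α : ℝ) (h : ℕ → ℕ) (ξ : ℂ) (n : ℕ) : ℂ :=
  seriesCoeff α h (etaVar ρ ξ) n * zVar ρ ξ ^ n

/-- The Lamé function `LS^R` of type 2 and of the second kind, as the sum of its power series
(meaningful where the series converges). -/
def LS (ρ α : ℝ) (h : ℕ → ℕ) (ξ : ℂ) : ℂ :=
  ξ ^ (1 / 2 : ℂ) * ∑' n, seriesTerm ρ α h ξ n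

/-! ### The integral operators -/

/-- The power `w ^ s`, in the branch that is analytic near `w₀ ≠ 0` and takes the principal
value at `w₀`. -/
def branchPow (w₀ s w : ℂ) : ℂ := Complex.exp (s * (Complex.log w₀ + Complex.log (w / w₀)))

/-- The operator `w^{-(2l-1+α/2)} (w ∂_w) w^{α+1/2} (w ∂_w) w^{2l-3/2-α/2}` applied to `F` and
evaluated at `w₀ ≠ 0`. All powers are taken in one branch near `w₀`; the value does not depend
on the branch, since the exponents add up to zero. -/
def diffOp (α : ℝ) (l : ℕ) (F : ℂ → ℂ) (w₀ : ℂ) : ℂ :=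
  branchPow w₀ (-(2 * (l : ℂ) - 1 + α / 2)) w₀ *
    (w₀ * deriv (fun w => branchPow w₀ ((α : ℂ) + 1 / 2) w *
      (w * deriv (fun y => branchPow w₀ (2 * (l : ℂ) - 3 / 2 - α / 2) y * F y) w)) w₀)

/-- The substitution `w ↦ v/(v-1) · w t u / (1 - w v (1-t)(1-u))`, which produces
`w_{i,n}` from `w_{i+1,n}`. -/
def nextW (w : ℂ) (t u : ℝ) (v : ℂ) : ℂ :=
  v / (v - 1) * (w * t * u / (1 - w * v * (1 - t) * (1 - u)))

/-- The integrand of the contour integral at level `l`, with `w = w_{l+1,n}`. -/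
def kernel (α : ℝ) (h : ℕ → ℕ) (l : ℕ) (F : ℂ → ℂ) (w : ℂ) (t u : ℝ) (v : ℂ) : ℂ :=
  1 / v * ((v - 1) / v * (1 / (1 - w * (1 - t) * (1 - u) * v))) ^ h l *
    (1 - w * (1 - t) * (1 - u) * v) ^ (-(4 * (l : ℤ) + 1)) *
    diffOp α l F (nextW w t u v)

/-- The level `l` integral operator; the contour is the circle about `0` of radius
`r l w t u`. -/
def intOp (r : ℕ → ℂ → ℝ → ℝ → ℝ) (α : ℝ) (h : ℕ → ℕ) (l : ℕ) (F : ℂ → ℂ) (w : ℂ) : ℂ :=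
  ∫ t in (0 : ℝ)..1, ((t ^ (2 * (l : ℝ) - 1 / 2) : ℝ) : ℂ) *
    ∫ u in (0 : ℝ)..1, ((u ^ (2 * (l : ℝ) - 1) : ℝ) : ℂ) *
      ((2 * (Real.pi : ℂ) * Complex.I)⁻¹ * ∮ v in C(0, r l w t u), kernel α h l F w t u v)

/-- The hypergeometric polynomial `₂F₁(-h₀, h₀+1; 3/2; w)`. -/
def hyp (h : ℕ → ℕ) (w : ℂ) : ℂ :=
  ordinaryHypergeometric (-(h 0 : ℂ)) ((h 0 : ℂ) + 1) (3 / 2 : ℂ) w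

/-- The `n`-fold nested integral: the level `n` operator outermost, the level `1` operator
innermost, applied to `₂F₁(-h₀, h₀+1; 3/2; ·)`. -/
def nested (r : ℕ → ℂ → ℝ → ℝ → ℝ) (α : ℝ) (h : ℕ → ℕ) : ℕ → ℂ → ℂ
  | 0 => hyp h
  | l + 1 => intOp r α h (l + 1) (nested r α h l)

/-- The contours enclose the pole `0` and leave the pole `1 / (w (1-t)(1-u))` outside. -/
def AdmissibleRadius (r : ℕ → ℂ → ℝ → ℝ → ℝ) : Prop :=
  ∀ (l : ℕ) (w : ℂ) (t u : ℝ), t ∈ Set.Icc (0 : ℝ) 1 → u ∈ Set.Icc (0 : ℝ) 1 →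
    0 < r l w t u ∧ r l w t u * ‖w * (1 - (t : ℂ)) * (1 - (u : ℂ))‖ < 1

end LameTypeTwo

end

noncomputable section

namespace LameTypeTwo

/-! ### The differential operator on polynomials -/

/-! Each operator $T_l$ acts on monomials explicitly. The operator $D_l$ multiplies $y^j$ by
$(2l-1+\frac\alpha2+j)(2l-\frac32-\frac\alpha2+j)$, the numerator of $B_{l-1}(j)$. Inserting $\tilde
w^j$ into the kernel changes the exponent of $(v-1)/v$ to $h_l-j$ and that of $1-sv$, with
$s=w(1-t)(1-u)$, to $-(h_l+j+4l+1)$. The residue at $v=0$ is a polynomial in $s$, and the $t$- and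
$u$-integrals of its terms are Beta integrals. Altogether $T_l w^j=\sum_m
B_{l-1}(j)R_l(j,j+m)\,w^{j+m}$ for $j\le h_l$ and $w\ne0$ (`contour_kernel`, `intOp_polynomial`,
`seriesFactor_mul_seriesRatio`).

So iterating the $T_l$ on the hypergeometric polynomial multiplies its coefficient vector by the
matrices $B_{l-1}(j)R_l(j,i)$. The nested sums of the series are the same matrix product, bracketed
from the other end (`sum_etaCoeff_mul_seriesTail`), hence `nested_eq_sum`.

If $(h_j)$ is bounded it is eventually constant, and these matrices tend to the identity; a ratio
test on the $\ell^1$ norm of the coefficient vectors gives convergence for $|z|<1$. -/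

lemma hasDerivAt_branchPow {w₀ s w : ℂ} (hw : w / w₀ ∈ Complex.slitPlane) :
    HasDerivAt (branchPow w₀ s) (s / w * branchPow w₀ s w) w := by
  have h0 : w / w₀ ≠ 0 := Complex.slitPlane_ne_zero hw
  have hw0 : w ≠ 0 := fun h => h0 (by simp [h])
  have hw₀ : w₀ ≠ 0 := fun h => h0 (by simp [h])
  have h1 := (((((hasDerivAt_id w).div_const w₀).clog hw).const_add (Complex.log w₀)).const_mul
    s).cexp
  refine h1.congr_deriv ?_
  simp only [branchPow, id]
  field_simp

lemma eventually_div_mem_slitPlane {w₀ : ℂ} (hw₀ : w₀ ≠ 0) :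
    ∀ᶠ w in nhds w₀, w / w₀ ∈ Complex.slitPlane := by
  have hc : ContinuousAt (fun w : ℂ => w / w₀) w₀ := continuousAt_id.div_const w₀
  refine hc.eventually_mem (Complex.isOpen_slitPlane.mem_nhds ?_)
  simp [hw₀]

/-- Hypothesis and conclusion are equalities of germs at `w₀`, so that the rule can be applied twice
in succession. -/
lemma euler_branchPow_mul_sum {w₀ s : ℂ} (hw₀ : w₀ ≠ 0) (S : Finset ℕ) (a : ℕ → ℂ) {F : ℂ → ℂ}
    (hF : F =ᶠ[nhds w₀] fun w => branchPow w₀ s w * ∑ j ∈ S, a j * w ^ j) :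
    (fun w => w * deriv F w) =ᶠ[nhds w₀]
      fun w => branchPow w₀ s w * ∑ j ∈ S, (s + j) * a j * w ^ j := by
  filter_upwards [hF.eventuallyEq_nhds, eventually_div_mem_slitPlane hw₀] with w h1 h2
  have hw : w ≠ 0 := fun h => Complex.slitPlane_ne_zero h2 (by simp [h])
  have hsum : HasDerivAt (fun w : ℂ => ∑ j ∈ S, a j * w ^ j)
      (∑ j ∈ S, a j * ((j : ℂ) * w ^ (j - 1))) w :=
    HasDerivAt.fun_sum fun j _ => (hasDerivAt_pow j w).const_mul (a j)
  rw [h1.deriv_eq, ((hasDerivAt_branchPow h2).fun_mul hsum).deriv]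
  have hj : w * ∑ j ∈ S, a j * ((j : ℂ) * w ^ (j - 1)) = ∑ j ∈ S, (j : ℂ) * (a j * w ^ j) := by
    rw [Finset.mul_sum]
    refine Finset.sum_congr rfl fun j _ => ?_
    rcases j with _ | j
    · simp
    · simp only [Nat.add_sub_cancel, pow_succ]; ring
  have hs : ∑ j ∈ S, (s + j) * a j * w ^ j
      = s * ∑ j ∈ S, a j * w ^ j + ∑ j ∈ S, (j : ℂ) * (a j * w ^ j) := by
    rw [Finset.mul_sum, ← Finset.sum_add_distrib]
    exact Finset.sum_congr rfl fun j _ => by ring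
  rw [hs, ← hj]
  field_simp

lemma branchPow_mul (w₀ s s' w : ℂ) :
    branchPow w₀ s w * branchPow w₀ s' w = branchPow w₀ (s + s') w := by
  simp only [branchPow, ← Complex.exp_add]; ring_nf

/-- Monomials are eigenvectors of the differential operator. -/
lemma diffOp_eq_sum (α : ℝ) (l : ℕ) {w₀ : ℂ} (hw₀ : w₀ ≠ 0) (S : Finset ℕ) (a : ℕ → ℂ)
    {F : ℂ → ℂ} (hF : F =ᶠ[nhds w₀] fun w => ∑ j ∈ S, a j * w ^ j) :
    diffOp α l F w₀ = ∑ j ∈ S, (2 * (l : ℂ) - 1 + α / 2 + j) *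
      ((2 * (l : ℂ) - 3 / 2 - α / 2 + j) * a j) * w₀ ^ j := by
  have h1 := euler_branchPow_mul_sum (s := 2 * (l : ℂ) - 3 / 2 - α / 2)
    (F := fun y => branchPow w₀ (2 * (l : ℂ) - 3 / 2 - α / 2) y * F y) hw₀ S a
    (by filter_upwards [hF] with w hw; rw [hw])
  -- The middle power raises the exponent to
  -- $(\alpha+\frac12)+(2l-\frac32-\frac\alpha2)=2l-1+\frac\alpha2$, which the outermost power
  -- cancels.
  have h2 := (euler_branchPow_mul_sum (s := 2 * (l : ℂ) - 1 + α / 2) hw₀ S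
    (fun j => (2 * (l : ℂ) - 3 / 2 - α / 2 + j) * a j)
    (F := fun w => branchPow w₀ ((α : ℂ) + 1 / 2) w *
      (w * deriv (fun y => branchPow w₀ (2 * (l : ℂ) - 3 / 2 - α / 2) y * F y) w))
    (by
      filter_upwards [h1] with w hw
      rw [hw, ← mul_assoc, branchPow_mul]
      congr 2
      ring)).eq_of_nhds
  rw [diffOp, h2, ← mul_assoc, branchPow_mul, neg_add_cancel]
  simp [branchPow]

/-! ### The contour integral -/

lemma circle_one_sub_ne_zero {s v : ℂ} {r : ℝ} (hrs : r * ‖s‖ < 1) (hv : ‖v‖ ≤ r) :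
    1 - s * v ≠ 0 := by
  intro h
  have h1 : ‖s * v‖ = 1 := by rw [← sub_eq_zero.mp h]; simp
  rw [norm_mul] at h1
  nlinarith [mul_le_mul_of_nonneg_left hv (norm_nonneg s)]

lemma circleIntegrable_pow_inv_mul {s : ℂ} {r : ℝ} (hr : 0 < r) (hrs : r * ‖s‖ < 1) (N k : ℕ) :
    CircleIntegrable (fun v : ℂ => (v ^ k)⁻¹ * ((1 - s * v) ^ N)⁻¹) 0 r := by
  refine ContinuousOn.circleIntegrable hr.le ?_
  have hv : ∀ v ∈ Metric.sphere (0 : ℂ) r, ‖v‖ = r := fun v h => by simpa using h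
  refine ContinuousOn.mul (ContinuousOn.inv₀ (by fun_prop) fun v h => ?_)
    (ContinuousOn.inv₀ (by fun_prop) fun v h => ?_)
  · refine pow_ne_zero _ (norm_pos_iff.mp ?_)
    rw [hv v h]; exact hr
  · exact pow_ne_zero _ (circle_one_sub_ne_zero hrs (hv v h).le)

/-- A residue obtained by double induction: the identity $1=(1-sv)+sv$ splits the integrand exactly
as Pascal's rule splits `Nat.multichoose`. -/
lemma circleIntegral_pow_inv_mul {s : ℂ} {r : ℝ} (hr : 0 < r) (hrs : r * ‖s‖ < 1) (N k : ℕ) :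
    (∮ v in C(0, r), (v ^ (k + 1))⁻¹ * ((1 - s * v) ^ N)⁻¹)
      = 2 * (Real.pi : ℂ) * Complex.I * (N.multichoose k * s ^ k) := by
  induction N generalizing k with
  | zero =>
    rcases k with _ | k
    · simpa using circleIntegral.integral_sub_center_inv (0 : ℂ) hr.ne'
    · have h := circleIntegral.integral_sub_zpow_of_ne (n := -((k : ℤ) + 2)) (by omega) 0 0 r
      simp only [sub_zero] at h
      simp only [pow_zero, inv_one, mul_one, Nat.multichoose_zero_succ, Nat.cast_zero, zero_mul,
        mul_zero]
      rw [← h]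
      congr 1
  | succ N ih =>
    induction k with
    | zero =>
      have hd : DifferentiableOn ℂ (fun v : ℂ => ((1 - s * v) ^ (N + 1))⁻¹)
          (Metric.closedBall 0 r) := by
        intro v hv
        have hd' : DifferentiableAt ℂ (fun v : ℂ => (1 - s * v) ^ (N + 1)) v := by fun_prop
        exact (hd'.inv (pow_ne_zero _ (circle_one_sub_ne_zero hrs
          (by simpa using hv)))).differentiableWithinAt
      have h := hd.circleIntegral_sub_inv_smul (Metric.mem_ball_self hr)
      simpa using h
    | succ k ihk =>
      have hi1 := circleIntegrable_pow_inv_mul hr hrs N (k + 2)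
      have hi2 := (circleIntegrable_pow_inv_mul hr hrs (N + 1) (k + 1)).const_fun_smul (a := s)
      have h : (∮ v in C(0, r), (v ^ (k + 1 + 1))⁻¹ * ((1 - s * v) ^ (N + 1))⁻¹)
          = ∮ v in C(0, r), ((v ^ (k + 2))⁻¹ * ((1 - s * v) ^ N)⁻¹
            + s • ((v ^ (k + 1))⁻¹ * ((1 - s * v) ^ (N + 1))⁻¹)) := by
        refine circleIntegral.integral_congr hr.le fun v hv => ?_
        have hv' : ‖v‖ = r := by simpa using hv
        have h0 : v ≠ 0 := norm_pos_iff.mp (by rw [hv']; exact hr)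
        have h1 := circle_one_sub_ne_zero hrs hv'.le
        simp only [smul_eq_mul]
        field_simp
        ring
      rw [h, circleIntegral.integral_add hi1 hi2, ih (k + 1), circleIntegral.integral_smul, ihk,
        Nat.multichoose_succ_succ]
      push_cast
      simp only [smul_eq_mul]
      ring

/-- The contour may pass through $v=1$, where the substitution `nextW` divides by zero; a single
point of the circle is negligible. -/
lemma circleIntegral_eq_of_ne_one {f g : ℂ → ℂ} {r : ℝ} (hr : 0 < r)
    (hfg : ∀ v, ‖v‖ = r → v ≠ 1 → f v = g v) :
    (∮ v in C(0, r), f v) = ∮ v in C(0, r), g v := by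
  have hc : (circleMap 0 r ⁻¹' {1}).Countable :=
    (Set.countable_singleton (1 : ℂ)).preimage_circleMap 0 hr.ne'
  refine intervalIntegral.integral_congr_ae ?_
  filter_upwards [hc.ae_notMem MeasureTheory.volume] with θ hθ _
  rw [hfg (circleMap 0 r θ) (by simp [abs_of_pos hr]) (by simpa using hθ)]

/-- Binomial expansion of $(1-v^{-1})^p$ reduces the integral to the residues above. -/
lemma contour_eq_sum {s : ℂ} {r : ℝ} (hr : 0 < r) (hrs : r * ‖s‖ < 1) (N p : ℕ) :
    CircleIntegrable (fun v : ℂ => 1 / v * (((v - 1) / v) ^ p * ((1 - s * v) ^ N)⁻¹)) 0 r ∧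
    (2 * (Real.pi : ℂ) * Complex.I)⁻¹ *
      (∮ v in C(0, r), 1 / v * (((v - 1) / v) ^ p * ((1 - s * v) ^ N)⁻¹))
      = ∑ m ∈ Finset.range (p + 1), (-1) ^ m * p.choose m * N.multichoose m * s ^ m := by
  have hi : ∀ m ∈ Finset.range (p + 1), CircleIntegrable (fun v : ℂ =>
      ((-1) ^ m * p.choose m : ℂ) • ((v ^ (m + 1))⁻¹ * ((1 - s * v) ^ N)⁻¹)) 0 r := fun m _ =>
    (circleIntegrable_pow_inv_mul hr hrs N (m + 1)).const_fun_smul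
  have hsum := CircleIntegrable.fun_sum (Finset.range (p + 1)) hi
  have heq : Set.EqOn (fun v : ℂ => 1 / v * (((v - 1) / v) ^ p * ((1 - s * v) ^ N)⁻¹))
      (fun v => ∑ m ∈ Finset.range (p + 1), ((-1) ^ m * p.choose m : ℂ) •
        ((v ^ (m + 1))⁻¹ * ((1 - s * v) ^ N)⁻¹)) (Metric.sphere 0 r) := by
    intro v hv
    have hv' : ‖v‖ = r := by simpa using hv
    have h0 : v ≠ 0 := norm_pos_iff.mp (by rw [hv']; exact hr)
    have hvv : (v - 1) / v = -v⁻¹ + 1 := by field_simp; ring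
    simp only [hvv, add_pow, one_pow, mul_one, Finset.sum_mul, Finset.mul_sum, smul_eq_mul]
    refine Finset.sum_congr rfl fun m _ => ?_
    rw [neg_pow, inv_pow, pow_succ, mul_inv]
    ring
  refine ⟨(circleIntegrable_congr (by rwa [abs_of_pos hr])).mpr hsum, ?_⟩
  rw [circleIntegral.integral_congr hr.le heq, circleIntegral.integral_fun_sum hi, Finset.mul_sum]
  refine Finset.sum_congr rfl fun m _ => ?_
  rw [circleIntegral.integral_smul, circleIntegral_pow_inv_mul hr hrs]
  have := Complex.two_pi_I_ne_zero
  simp only [smul_eq_mul]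
  field_simp

/-! ### Pochhammer symbols and Beta integrals -/

lemma poch_zero (x : ℂ) : poch x 0 = 1 := by simp [poch]

lemma poch_succ (x : ℂ) (m : ℕ) : poch x (m + 1) = poch x m * (x + m) := by
  simp [poch, ascPochhammer_succ_eval]

lemma poch_add (x : ℂ) (j m : ℕ) : poch x (j + m) = poch x j * poch (x + j) m := by
  simp [poch, ← ascPochhammer_mul]

lemma poch_succ_left (x : ℂ) (m : ℕ) : poch x (m + 1) = x * poch (x + 1) m := by
  rw [add_comm, poch_add, poch_succ, poch_zero]; simp

lemma poch_eq_prod (x : ℂ) (m : ℕ) : poch x m = ∏ q ∈ Finset.range m, (x + q) := by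
  induction m with
  | zero => simp [poch_zero]
  | succ m ih => rw [poch_succ, Finset.prod_range_succ, ih]

lemma poch_ne_zero {x : ℂ} (hx : 0 < x.re) (m : ℕ) : poch x m ≠ 0 := by
  rw [poch_eq_prod, Finset.prod_ne_zero_iff]
  intro q _ h0
  have := congrArg Complex.re h0
  simp only [Complex.add_re, Complex.natCast_re, Complex.zero_re] at this
  have : (0 : ℝ) ≤ q := q.cast_nonneg
  linarith

lemma poch_neg_ne_zero {p j : ℕ} (hj : j ≤ p) : poch (-(p : ℂ)) j ≠ 0 := by
  rw [poch_eq_prod, Finset.prod_ne_zero_iff]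
  intro q hq h0
  have h1 : (q : ℂ) = p := by linear_combination h0
  have h2 : q = p := by exact_mod_cast h1
  rw [Finset.mem_range] at hq
  omega

lemma poch_neg_eq_zero {p j : ℕ} (hj : p < j) : poch (-(p : ℂ)) j = 0 := by
  rw [poch_eq_prod]
  exact Finset.prod_eq_zero (Finset.mem_range.mpr hj) (by simp)

lemma poch_neg_natCast (p m : ℕ) :
    poch (-(p : ℂ)) m = (-1) ^ m * p.choose m * m.factorial := by
  induction m with
  | zero => simp [poch_zero]
  | succ m ih =>
    have h : ((p.choose (m + 1) : ℂ)) * (m + 1) = p.choose m * (p - m) := by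
      rcases le_or_gt m p with hm | hm
      · rw [← Nat.cast_sub hm]
        exact_mod_cast Nat.choose_succ_right_eq p m
      · simp [Nat.choose_eq_zero_of_lt hm, Nat.choose_eq_zero_of_lt (hm.trans (Nat.lt_succ_self m))]
    rw [poch_succ, ih, Nat.factorial_succ]
    push_cast
    linear_combination (-1) ^ m * (m.factorial : ℂ) * h

lemma poch_natCast (N m : ℕ) : poch (N : ℂ) m = N.multichoose m * m.factorial := by
  rw [poch, ← ascPochhammer_eval_cast, ascPochhammer_nat_eq_ascFactorial,
    Nat.ascFactorial_eq_factorial_mul_choose', Nat.multichoose_eq]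
  push_cast
  ring

lemma poch_one (m : ℕ) : poch 1 m = m.factorial := by
  simpa [Nat.multichoose_one] using poch_natCast 1 m

lemma integral_rpow_mul_pow {a : ℝ} (ha : 0 ≤ a) (e m : ℕ) :
    (∫ t in (0 : ℝ)..1, ((t ^ a : ℝ) : ℂ) * ((t : ℂ) ^ e * (1 - (t : ℂ)) ^ m))
      = m.factorial / poch (a + 1 + e) (m + 1) := by
  have h := Complex.betaIntegral_eval_nat_add_one_right (u := (a : ℂ) + 1 + e)
    (by simp; positivity) m
  rw [← poch_eq_prod] at h
  rw [← h, Complex.betaIntegral]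
  refine intervalIntegral.integral_congr_ae (Filter.Eventually.of_forall fun t ht => ?_)
  rw [Set.uIoc_of_le zero_le_one] at ht
  have ht0 : (t : ℂ) ≠ 0 := by exact_mod_cast ht.1.ne'
  have h1 : (a : ℂ) + 1 + e - 1 = a + e := by ring
  rw [h1, Complex.cpow_add _ _ ht0, Complex.cpow_natCast, Complex.ofReal_cpow ht.1.le]
  simp [mul_assoc]

lemma intervalIntegrable_rpow_mul_pow {a : ℝ} (ha : 0 ≤ a) (e m : ℕ) (c : ℂ) :
    IntervalIntegrable (fun t : ℝ => c * (((t ^ a : ℝ) : ℂ) * ((t : ℂ) ^ e * (1 - (t : ℂ)) ^ m)))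
      MeasureTheory.volume 0 1 := by
  refine Continuous.intervalIntegrable ?_ 0 1
  have : Continuous fun t : ℝ => t ^ a := Real.continuous_rpow_const ha
  fun_prop

lemma integral_rpow_mul_sum {ι : Type*} {a : ℝ} (ha : 0 ≤ a) (K : Finset ι) (e m : ι → ℕ)
    (c : ι → ℂ) {G : ℝ → ℂ} (hG : ∀ t ∈ Set.Ioc (0 : ℝ) 1,
      G t = ∑ x ∈ K, c x * ((t : ℂ) ^ e x * (1 - (t : ℂ)) ^ m x)) :
    (∫ t in (0 : ℝ)..1, ((t ^ a : ℝ) : ℂ) * G t)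
      = ∑ x ∈ K, c x * ((m x).factorial / poch (a + 1 + e x) (m x + 1)) := by
  have h : (∫ t in (0 : ℝ)..1, ((t ^ a : ℝ) : ℂ) * G t) = ∫ t in (0 : ℝ)..1, ∑ x ∈ K,
      c x * (((t ^ a : ℝ) : ℂ) * ((t : ℂ) ^ e x * (1 - (t : ℂ)) ^ m x)) := by
    refine intervalIntegral.integral_congr_ae (Filter.Eventually.of_forall fun t ht => ?_)
    rw [Set.uIoc_of_le zero_le_one] at ht
    simp only [hG t ht, Finset.mul_sum]
    exact Finset.sum_congr rfl fun x _ => by ring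
  rw [h, intervalIntegral.integral_finsetSum
    fun x _ => intervalIntegrable_rpow_mul_pow ha (e x) (m x) (c x)]
  refine Finset.sum_congr rfl fun x _ => ?_
  rw [intervalIntegral.integral_const_mul, integral_rpow_mul_pow ha]

/-! ### The integral operator on polynomials -/

lemma contour_kernel (α : ℝ) (h : ℕ → ℕ) (l H : ℕ) (hH : H ≤ h l) (a : ℕ → ℂ) {F : ℂ → ℂ}
    (hF : ∀ y, y ≠ 0 → F y = ∑ j ∈ Finset.range (H + 1), a j * y ^ j) {w : ℂ} (hw : w ≠ 0)
    {t u r : ℝ} (ht : 0 < t) (hu : 0 < u) (hr : 0 < r)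
    (hrs : r * ‖w * (1 - (t : ℂ)) * (1 - (u : ℂ))‖ < 1) :
    (2 * (Real.pi : ℂ) * Complex.I)⁻¹ * (∮ v in C(0, r), kernel α h l F w t u v)
      = ∑ j ∈ Finset.range (H + 1), ∑ m ∈ Finset.range (h l - j + 1),
        (2 * (l : ℂ) - 1 + α / 2 + j) * ((2 * (l : ℂ) - 3 / 2 - α / 2 + j) * a j) *
          (w * t * u) ^ j * ((-1) ^ m * (h l - j).choose m *
            (h l + j + 4 * l + 1).multichoose m * (w * (1 - t) * (1 - u)) ^ m) := by
  set s := w * (1 - (t : ℂ)) * (1 - (u : ℂ)) with hs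
  set b : ℕ → ℂ := fun j =>
    (2 * (l : ℂ) - 1 + α / 2 + j) * ((2 * (l : ℂ) - 3 / 2 - α / 2 + j) * a j) *
      (w * t * u) ^ j with hb
  have hk : (∮ v in C(0, r), kernel α h l F w t u v) = ∮ v in C(0, r),
      ∑ j ∈ Finset.range (H + 1), b j • (1 / v * (((v - 1) / v) ^ (h l - j) *
        ((1 - s * v) ^ (h l + j + 4 * l + 1))⁻¹)) := by
    refine circleIntegral_eq_of_ne_one hr fun v hv hv1 => ?_
    have h0 : v ≠ 0 := norm_pos_iff.mp (by rw [hv]; exact hr)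
    have h1 : v - 1 ≠ 0 := sub_ne_zero.mpr hv1
    have hY := circle_one_sub_ne_zero hrs hv.le
    have hne : nextW w t u v ≠ 0 := by
      have : 1 - w * v * (1 - (t : ℂ)) * (1 - (u : ℂ)) ≠ 0 := by
        convert hY using 2; rw [hs]; ring
      have ht' : (t : ℂ) ≠ 0 := by exact_mod_cast ht.ne'
      have hu' : (u : ℂ) ≠ 0 := by exact_mod_cast hu.ne'
      simp only [nextW]
      positivity
    have hX : nextW w t u v = ((v - 1) / v)⁻¹ * (w * t * u / (1 - s * v)) := by
      rw [nextW, inv_div, hs]; ring_nf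
    have hX0 : (v - 1) / v ≠ 0 := div_ne_zero h1 h0
    rw [kernel, diffOp_eq_sum α l hne (Finset.range (H + 1)) a
      (by filter_upwards [isOpen_ne.mem_nhds hne] with y hy using hF y hy), hX, ← hs, Finset.mul_sum]
    refine Finset.sum_congr rfl fun j hj => ?_
    have hjl : j ≤ h l := by rw [Finset.mem_range] at hj; omega
    -- Since $j\le h_l$, the factor $((v-1)/v)^{-j}$ from $\tilde w^j$ is absorbed by
    -- $((v-1)/v)^{h_l}$, leaving the exponent $p=h_l-j\ge0$: the singularity at $v=1$ is removable.
    obtain ⟨p, hp⟩ := Nat.exists_eq_add_of_le hjl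
    rw [hp, Nat.add_sub_cancel_left, zpow_neg]
    have hz : (1 - s * v) ^ (4 * (l : ℤ) + 1) = (1 - s * v) ^ (4 * l + 1) := by norm_cast
    rw [hz, smul_eq_mul, hb]
    generalize (v - 1) / v = X at *
    generalize 1 - s * v = Y at *
    simp only [mul_pow, div_pow, inv_pow, one_pow]
    field_simp
    ring
  rw [hk, circleIntegral.integral_fun_sum, Finset.mul_sum]
  · refine Finset.sum_congr rfl fun j _ => ?_
    rw [circleIntegral.integral_smul, smul_eq_mul, mul_left_comm, (contour_eq_sum hr hrs _ _).2,
      Finset.mul_sum]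
  · exact fun j _ => (contour_eq_sum hr hrs _ _).1.const_fun_smul

lemma intOp_polynomial (r : ℕ → ℂ → ℝ → ℝ → ℝ) (hr : AdmissibleRadius r) (α : ℝ) (h : ℕ → ℕ)
    {l H : ℕ} (hl : 1 ≤ l) (hH : H ≤ h l) (a : ℕ → ℂ) {F : ℂ → ℂ}
    (hF : ∀ y, y ≠ 0 → F y = ∑ j ∈ Finset.range (H + 1), a j * y ^ j) {w : ℂ} (hw : w ≠ 0) :
    intOp r α h l F w
      = ∑ j ∈ Finset.range (H + 1), ∑ m ∈ Finset.range (h l - j + 1),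
        (2 * (l : ℂ) - 1 + α / 2 + j) * ((2 * (l : ℂ) - 3 / 2 - α / 2 + j) * a j) * w ^ (j + m) *
          ((-1) ^ m * (h l - j).choose m * (h l + j + 4 * l + 1).multichoose m) *
          (m.factorial / poch (2 * l + j) (m + 1)) *
          (m.factorial / poch (2 * l + 1 / 2 + j) (m + 1)) := by
  have hl' : (1 : ℝ) ≤ l := by exact_mod_cast hl
  rw [Finset.sum_sigma', intOp]
  set K := (Finset.range (H + 1)).sigma fun j => Finset.range (h l - j + 1)
  set c : (Σ _ : ℕ, ℕ) → ℂ := fun x =>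
    (2 * (l : ℂ) - 1 + α / 2 + x.1) * ((2 * (l : ℂ) - 3 / 2 - α / 2 + x.1) * a x.1) *
      w ^ (x.1 + x.2) *
      ((-1) ^ x.2 * (h l - x.1).choose x.2 * (h l + x.1 + 4 * l + 1).multichoose x.2) with hc
  have hu : ∀ t ∈ Set.Ioc (0 : ℝ) 1, (∫ u in (0 : ℝ)..1, ((u ^ (2 * (l : ℝ) - 1) : ℝ) : ℂ) *
      ((2 * (Real.pi : ℂ) * Complex.I)⁻¹ * ∮ v in C(0, r l w t u), kernel α h l F w t u v))
      = ∑ x ∈ K, (c x * (x.2.factorial / poch (2 * l + x.1) (x.2 + 1))) *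
        ((t : ℂ) ^ x.1 * (1 - (t : ℂ)) ^ x.2) := by
    intro t ht
    rw [integral_rpow_mul_sum (by linarith) K (fun x => x.1) (fun x => x.2)
      (fun x => c x * ((t : ℂ) ^ x.1 * (1 - (t : ℂ)) ^ x.2))]
    · refine Finset.sum_congr rfl fun x _ => ?_
      push_cast
      ring_nf
    · intro u hu
      obtain ⟨h1, h2⟩ := hr l w t u (Set.Ioc_subset_Icc_self ht) (Set.Ioc_subset_Icc_self hu)
      rw [contour_kernel α h l H hH a hF hw ht.1 hu.1 h1 h2, Finset.sum_sigma']
      refine Finset.sum_congr rfl fun x _ => ?_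
      simp only [hc, mul_pow, pow_add]
      ring
  rw [integral_rpow_mul_sum (by linarith) K (fun x => x.1) (fun x => x.2) _ hu]
  refine Finset.sum_congr rfl fun x _ => ?_
  have : ((2 * (l : ℝ) - 1 / 2 : ℝ) : ℂ) + 1 + x.1 = 2 * l + 1 / 2 + x.1 := by push_cast; ring
  rw [this]

/-- The two factorials from the Beta integrals turn the binomial and multiset coefficients into
$(-h_l+j)_m$ and $(h_l+j+4l+1)_m$, with $l=k+1$. The leading factors of the two Beta denominators
are the denominator of $B_k(j)$; the rest follows from $(x)_{j+m}=(x)_j(x+j)_m$. -/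
lemma seriesFactor_mul_seriesRatio (α : ℝ) (h : ℕ → ℕ) {k j m : ℕ} (hm : j + m ≤ h (k + 1)) :
    (2 * ((k + 1 : ℕ) : ℂ) - 1 + α / 2 + j) * (2 * ((k + 1 : ℕ) : ℂ) - 3 / 2 - α / 2 + j) *
      ((-1) ^ m * (h (k + 1) - j).choose m *
        (h (k + 1) + j + 4 * (k + 1) + 1).multichoose m) *
      (m.factorial / poch (2 * ((k + 1 : ℕ) : ℂ) + j) (m + 1)) *
      (m.factorial / poch (2 * ((k + 1 : ℕ) : ℂ) + 1 / 2 + j) (m + 1))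
      = seriesFactor α k j * seriesRatio h (k + 1) j (j + m) := by
  have hj : j ≤ h (k + 1) := by omega
  have e1 : poch (-(h (k + 1) : ℂ)) (j + m) = poch (-(h (k + 1) : ℂ)) j *
      ((-1) ^ m * (h (k + 1) - j).choose m * m.factorial) := by
    rw [poch_add, ← poch_neg_natCast, Nat.cast_sub hj]; ring_nf
  have e2 : poch ((h (k + 1) : ℂ) + 4 * ((k + 1 : ℕ) : ℂ) + 1) (j + m) =
      poch ((h (k + 1) : ℂ) + 4 * ((k + 1 : ℕ) : ℂ) + 1) j *
      ((h (k + 1) + j + 4 * (k + 1) + 1).multichoose m * m.factorial) := by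
    rw [poch_add, ← poch_natCast]; push_cast; ring_nf
  have n1 := poch_neg_ne_zero hj
  have n2 : poch ((h (k + 1) : ℂ) + 4 * ((k + 1 : ℕ) : ℂ) + 1) j ≠ 0 :=
    poch_ne_zero (by simp; positivity) _
  have n3 : poch (2 * ((k + 1 : ℕ) : ℂ) + 3 / 2) j ≠ 0 := poch_ne_zero (by simp; positivity) _
  have n4 : poch (2 * ((k + 1 : ℕ) : ℂ) + 1) j ≠ 0 := poch_ne_zero (by simp; positivity) _
  have n5 : poch (2 * ((k + 1 : ℕ) : ℂ) + 3 / 2 + j) m ≠ 0 :=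
    poch_ne_zero (by simp; positivity) _
  have n6 : poch (2 * ((k + 1 : ℕ) : ℂ) + 1 + j) m ≠ 0 := poch_ne_zero (by simp; positivity) _
  have d1 : (j : ℂ) + 2 * k + 2 ≠ 0 := by
    norm_cast
  have d2 : (j : ℂ) + 2 * k + 5 / 2 ≠ 0 := by
    intro h0
    have h1 := congrArg Complex.re h0
    norm_num at h1
    have h2 : (0 : ℝ) ≤ j + 2 * k := by positivity
    linarith
  have f1 : poch (2 * ((k + 1 : ℕ) : ℂ) + j) (m + 1)
      = (j + 2 * k + 2) * poch (2 * ((k + 1 : ℕ) : ℂ) + 1 + j) m := by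
    rw [poch_succ_left]; push_cast; ring_nf
  have f2 : poch (2 * ((k + 1 : ℕ) : ℂ) + 1 / 2 + j) (m + 1)
      = (j + 2 * k + 5 / 2) * poch (2 * ((k + 1 : ℕ) : ℂ) + 3 / 2 + j) m := by
    rw [poch_succ_left]; push_cast; ring_nf
  have g1 : (2 * ((k + 1 : ℕ) : ℂ) - 1 + α / 2 + j) = j + 2 * k + α / 2 + 1 := by push_cast; ring
  have g2 : (2 * ((k + 1 : ℕ) : ℂ) - 3 / 2 - α / 2 + j) = j + 2 * k - α / 2 + 1 / 2 := by
    push_cast; ring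
  rw [seriesFactor, seriesRatio, e1, e2, f1, f2, g1, g2, poch_add (2 * ((k + 1 : ℕ) : ℂ) + 3 / 2),
    poch_add (2 * ((k + 1 : ℕ) : ℂ) + 1)]
  generalize ((h (k + 1) + j + 4 * (k + 1) + 1).multichoose m : ℂ) = M at *
  generalize poch (2 * ((k + 1 : ℕ) : ℂ) + 3 / 2 + j) m = P5 at *
  generalize poch (2 * ((k + 1 : ℕ) : ℂ) + 1 + j) m = P6 at *
  generalize poch (2 * ((k + 1 : ℕ) : ℂ) + 3 / 2) j = P3 at *
  generalize poch (2 * ((k + 1 : ℕ) : ℂ) + 1) j = P4 at *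
  generalize poch ((h (k + 1) : ℂ) + 4 * ((k + 1 : ℕ) : ℂ) + 1) j = P2 at *
  generalize poch (-(h (k + 1) : ℂ)) j = P1 at *
  generalize (j : ℂ) + 2 * k + 5 / 2 = D2 at *
  generalize (j : ℂ) + 2 * k + 2 = D1 at *
  field_simp

/-! ### The coefficients of the polynomials in `η` -/

/-- The coefficient of `η ^ i` in `seriesCoeff α h η n`. -/
def etaCoeff (α : ℝ) (h : ℕ → ℕ) : ℕ → ℕ → ℂ
  | 0, i => seriesInit h i
  | n + 1, i => ∑ j ∈ Finset.range (h n + 1),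
      if j ≤ i then etaCoeff α h n j * (seriesFactor α n j * seriesRatio h (n + 1) j i) else 0

lemma sum_range_sum_Icc {M : Type*} [AddCommMonoid M] (A B : ℕ) (f : ℕ → ℕ → M) :
    ∑ j ∈ Finset.range (A + 1), ∑ i ∈ Finset.Icc j B, f j i
      = ∑ i ∈ Finset.range (B + 1), ∑ j ∈ Finset.range (A + 1), if j ≤ i then f j i else 0 := by
  rw [Finset.sum_comm]
  refine Finset.sum_congr rfl fun j _ => ?_
  rw [← Finset.sum_filter]
  refine Finset.sum_congr ?_ fun _ _ => rfl
  ext i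
  simp only [Finset.mem_Icc, Finset.mem_filter, Finset.mem_range]
  omega

lemma sum_etaCoeff_succ (α : ℝ) (h : ℕ → ℕ) (n : ℕ) (g : ℕ → ℂ) :
    ∑ i ∈ Finset.range (h (n + 1) + 1), etaCoeff α h (n + 1) i * g i
      = ∑ j ∈ Finset.range (h n + 1), ∑ i ∈ Finset.Icc j (h (n + 1)),
        etaCoeff α h n j * (seriesFactor α n j * seriesRatio h (n + 1) j i) * g i := by
  rw [sum_range_sum_Icc]
  refine Finset.sum_congr rfl fun i _ => ?_
  rw [etaCoeff, Finset.sum_mul]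
  exact Finset.sum_congr rfl fun j _ => by rw [ite_mul, zero_mul]

/-- Induction on the depth of the tail: each step moves its outermost summation into the coefficient
vector. -/
lemma sum_etaCoeff_mul_seriesTail (α : ℝ) (h : ℕ → ℕ) (η : ℂ) (m k : ℕ) :
    ∑ j ∈ Finset.range (h k + 1),
        etaCoeff α h k j * (seriesFactor α k j * seriesTail α h η m (k + 1) j)
      = ∑ i ∈ Finset.range (h (k + 1 + m) + 1), etaCoeff α h (k + 1 + m) i * η ^ i := by
  induction m generalizing k with
  | zero =>
    rw [add_zero, sum_etaCoeff_succ]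
    refine Finset.sum_congr rfl fun j _ => ?_
    rw [seriesTail, Finset.mul_sum, Finset.mul_sum]
    exact Finset.sum_congr rfl fun i _ => by ring
  | succ m ih =>
    have e : k + 1 + (m + 1) = k + 1 + 1 + m := by ring
    rw [e, ← ih (k + 1), sum_etaCoeff_succ]
    refine Finset.sum_congr rfl fun j _ => ?_
    rw [seriesTail, Finset.mul_sum, Finset.mul_sum]
    exact Finset.sum_congr rfl fun i _ => by ring

lemma Icc_zero_eq_range (n : ℕ) : Finset.Icc 0 n = Finset.range (n + 1) := by
  ext i; simp

lemma seriesCoeff_eq_sum (α : ℝ) (h : ℕ → ℕ) (η : ℂ) (n : ℕ) :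
    seriesCoeff α h η n = ∑ i ∈ Finset.range (h n + 1), etaCoeff α h n i * η ^ i := by
  rcases n with _ | m
  · simp only [seriesCoeff, Icc_zero_eq_range, etaCoeff]
  · have h1 := sum_etaCoeff_mul_seriesTail α h η m 0
    rw [zero_add, add_comm 1 m] at h1
    rw [← h1, seriesCoeff, Icc_zero_eq_range]
    exact Finset.sum_congr rfl fun i _ => by rw [etaCoeff]; ring

lemma hyp_eq_sum (α : ℝ) (h : ℕ → ℕ) (w : ℂ) :
    hyp h w = ∑ i ∈ Finset.range (h 0 + 1), etaCoeff α h 0 i * w ^ i := by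
  rw [hyp, ordinaryHypergeometric_eq_tsum]
  simp only
  rw [tsum_eq_sum (s := Finset.range (h 0 + 1))]
  · refine Finset.sum_congr rfl fun i _ => ?_
    rw [etaCoeff, seriesInit, poch_one]
    simp only [poch, smul_eq_mul, div_eq_mul_inv, mul_inv]
    ring
  · intro i hi
    have h0 : poch (-(h 0 : ℂ)) i = 0 := poch_neg_eq_zero (by simpa using hi)
    rw [poch] at h0
    simp [h0]

/-- Monotonicity gives $h_n\le h_{n+1}$, so every monomial present satisfies the degree bound of the
next operator. The point $w=0$ is excluded because `diffOp` is meaningful only away from $0$. -/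
lemma nested_eq_sum (r : ℕ → ℂ → ℝ → ℝ → ℝ) (hr : AdmissibleRadius r) (α : ℝ) (h : ℕ → ℕ)
    (hmono : Monotone h) (n : ℕ) (w : ℂ) (hw : w ≠ 0) :
    nested r α h n w = ∑ i ∈ Finset.range (h n + 1), etaCoeff α h n i * w ^ i := by
  induction n generalizing w with
  | zero => exact hyp_eq_sum α h w
  | succ n ih =>
    have hle := hmono (Nat.le_succ n)
    rw [nested, intOp_polynomial r hr α h (by omega) hle (etaCoeff α h n) ih hw,
      sum_etaCoeff_succ]
    refine Finset.sum_congr rfl fun j hj => ?_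
    have hj' : j ≤ h (n + 1) := (Nat.lt_succ_iff.mp (Finset.mem_range.mp hj)).trans hle
    have hI : Finset.Icc j (h (n + 1)) = Finset.Ico j (h (n + 1) + 1) := by
      ext i; simp only [Finset.mem_Icc, Finset.mem_Ico]; omega
    rw [hI, Finset.sum_Ico_eq_sum_range, Nat.sub_add_comm hj']
    refine Finset.sum_congr rfl fun m hm => ?_
    rw [← seriesFactor_mul_seriesRatio α h (by rw [Finset.mem_range] at hm; omega)]
    ring

/-! ### Convergence -/

lemma tendsto_affine_div_affine (a b c : ℂ) {d : ℂ} (hd : d ≠ 0) :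
    Filter.Tendsto (fun n : ℕ => (a + c * n) / (b + d * n)) Filter.atTop (nhds (c / d)) := by
  have hi := tendsto_inv_atTop_nhds_zero_nat (𝕜 := ℂ)
  have h1 : Filter.Tendsto (fun n : ℕ => (a * (n : ℂ)⁻¹ + c) / (b * (n : ℂ)⁻¹ + d)) Filter.atTop
      (nhds ((a * 0 + c) / (b * 0 + d))) :=
    ((hi.const_mul a).add_const c).div ((hi.const_mul b).add_const d) (by simpa using hd)
  rw [mul_zero, mul_zero, zero_add, zero_add] at h1
  refine h1.congr' ?_
  filter_upwards [Filter.eventually_ne_atTop 0] with n hn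
  have hn' : (n : ℂ) ≠ 0 := by exact_mod_cast hn
  rw [← mul_div_mul_right (a * (n : ℂ)⁻¹ + c) (b * (n : ℂ)⁻¹ + d) hn']
  congr 1 <;> field_simp

lemma tendsto_seriesFactor (α : ℝ) (j : ℕ) :
    Filter.Tendsto (fun n => seriesFactor α n j) Filter.atTop (nhds 1) := by
  have h := (tendsto_affine_div_affine (j + α / 2 + 1) (j + 5 / 2) 2 (two_ne_zero)).mul
    (tendsto_affine_div_affine (j - α / 2 + 1 / 2) (j + 2) 2 (two_ne_zero))
  rw [div_self two_ne_zero, mul_one] at h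
  refine h.congr fun n => ?_
  rw [seriesFactor, div_mul_div_comm]
  congr 2 <;> ring

lemma tendsto_seriesRatio {h : ℕ → ℕ} {H : ℕ} (hH : ∀ᶠ n in Filter.atTop, h n = H) {j i : ℕ}
    (hji : j ≤ i) (hi : i ≤ H) :
    Filter.Tendsto (fun n => seriesRatio h (n + 1) j i) Filter.atTop
      (nhds (if i = j then 1 else 0)) := by
  obtain ⟨m, rfl⟩ := Nat.exists_eq_add_of_le hji
  -- For $i=j+m$ the ratio contains $m$ such factors, each of order $1/n$; only the diagonal $m=0$
  -- survives in the limit.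
  have hf : ∀ q : ℕ, Filter.Tendsto (fun n : ℕ =>
      ((H + 5 + j + q : ℂ) + 4 * n) / ((2 + 3 / 2 + j + q : ℂ) + 2 * n) *
        ((1 + 0 * (n : ℂ)) / ((2 + 1 + j + q : ℂ) + 2 * n))) Filter.atTop (nhds 0) := fun q => by
    simpa using (tendsto_affine_div_affine (H + 5 + j + q) (2 + 3 / 2 + j + q) 4
      two_ne_zero).mul (tendsto_affine_div_affine 1 (2 + 1 + j + q) 0 two_ne_zero)
  have hp := (tendsto_finsetProd (Finset.range m) fun q _ => hf q).const_mul
    (poch (-(H : ℂ)) (j + m) / poch (-(H : ℂ)) j)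
  have hlim : poch (-(H : ℂ)) (j + m) / poch (-(H : ℂ)) j * ∏ _q ∈ Finset.range m, (0 : ℂ)
      = if j + m = j then 1 else 0 := by
    rcases m with _ | m
    · simpa using poch_neg_ne_zero hi
    · simp
  rw [hlim] at hp
  refine hp.congr' ?_
  filter_upwards [(Filter.tendsto_add_atTop_nat 1).eventually hH] with n hn
  have n2 : poch ((H : ℂ) + 4 * ((n + 1 : ℕ) : ℂ) + 1) j ≠ 0 :=
    poch_ne_zero (by simp; positivity) _
  have n3 : poch (2 * ((n + 1 : ℕ) : ℂ) + 3 / 2) j ≠ 0 := poch_ne_zero (by simp; positivity) _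
  have n4 : poch (2 * ((n + 1 : ℕ) : ℂ) + 1) j ≠ 0 := poch_ne_zero (by simp; positivity) _
  have e2 : ∏ q ∈ Finset.range m, ((H + 5 + j + q : ℂ) + 4 * n)
      = poch ((H : ℂ) + 4 * ((n + 1 : ℕ) : ℂ) + 1 + j) m := by
    rw [poch_eq_prod]; refine Finset.prod_congr rfl fun q _ => ?_; push_cast; ring
  have e3 : ∏ q ∈ Finset.range m, ((2 + 3 / 2 + j + q : ℂ) + 2 * n)
      = poch (2 * ((n + 1 : ℕ) : ℂ) + 3 / 2 + j) m := by
    rw [poch_eq_prod]; refine Finset.prod_congr rfl fun q _ => ?_; push_cast; ring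
  have e4 : ∏ q ∈ Finset.range m, ((2 + 1 + j + q : ℂ) + 2 * n)
      = poch (2 * ((n + 1 : ℕ) : ℂ) + 1 + j) m := by
    rw [poch_eq_prod]; refine Finset.prod_congr rfl fun q _ => ?_; push_cast; ring
  simp only [zero_mul, add_zero]
  rw [Finset.prod_mul_distrib, Finset.prod_div_distrib, Finset.prod_div_distrib, e2, e3, e4,
    Finset.prod_const_one, seriesRatio, hn, poch_add ((H : ℂ) + 4 * ((n + 1 : ℕ) : ℂ) + 1),
    poch_add (2 * ((n + 1 : ℕ) : ℂ) + 3 / 2), poch_add (2 * ((n + 1 : ℕ) : ℂ) + 1)]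
  generalize poch (2 * ((n + 1 : ℕ) : ℂ) + 3 / 2 + j) m = P5
  generalize poch (2 * ((n + 1 : ℕ) : ℂ) + 1 + j) m = P6
  generalize poch (2 * ((n + 1 : ℕ) : ℂ) + 3 / 2) j = P3 at *
  generalize poch (2 * ((n + 1 : ℕ) : ℂ) + 1) j = P4 at *
  field_simp

lemma eventually_const_of_bddAbove {h : ℕ → ℕ} (hmono : Monotone h)
    (hb : BddAbove (Set.range h)) : ∃ H, ∀ᶠ n in Filter.atTop, h n = H := by
  obtain ⟨N, hN⟩ := Nat.sSup_mem (Set.range_nonempty h) hb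
  refine ⟨h N, ?_⟩
  filter_upwards [Filter.eventually_ge_atTop N] with n hn
  exact le_antisymm (hN ▸ le_csSup hb ⟨n, rfl⟩) (hmono hn)

/-- The absolute column sums of the transition matrices tend to $1$, so after multiplication by $x$
they eventually lie below $(x+1)/2<1$, and the ratio test applies. -/
lemma summable_sum_norm_etaCoeff (α : ℝ) {h : ℕ → ℕ} {H : ℕ}
    (hH : ∀ᶠ n in Filter.atTop, h n = H) {x : ℝ} (hx0 : 0 ≤ x) (hx : x < 1) :
    Summable fun n => (∑ i ∈ Finset.range (h n + 1), ‖etaCoeff α h n i‖) * x ^ n := by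
  have hcol : ∀ j ∈ Finset.range (H + 1), ∀ᶠ n in Filter.atTop,
      (∑ i ∈ Finset.Icc j H, ‖seriesFactor α n j * seriesRatio h (n + 1) j i‖) * x
        ≤ (x + 1) / 2 := by
    intro j hj
    have hj' : j ≤ H := Nat.lt_succ_iff.mp (Finset.mem_range.mp hj)
    have ht : Filter.Tendsto (fun n => (∑ i ∈ Finset.Icc j H,
        ‖seriesFactor α n j * seriesRatio h (n + 1) j i‖) * x) Filter.atTop
        (nhds ((∑ i ∈ Finset.Icc j H, ‖(1 : ℂ) * if i = j then 1 else 0‖) * x)) := by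
      refine (tendsto_finsetSum _ fun i hi => ?_).mul_const x
      rw [Finset.mem_Icc] at hi
      exact ((tendsto_seriesFactor α j).mul (tendsto_seriesRatio hH hi.1 hi.2)).norm
    have hone : ∑ i ∈ Finset.Icc j H, ‖(1 : ℂ) * if i = j then 1 else 0‖ = 1 := by
      rw [Finset.sum_eq_single j]
      · simp
      · intro i _ hij; simp [hij]
      · intro hn; exact absurd (Finset.mem_Icc.mpr ⟨le_rfl, hj'⟩) hn
    rw [hone, one_mul] at ht
    exact ht.eventually_le_const (by linarith)
  refine summable_of_ratio_norm_eventually_le (r := (x + 1) / 2) (by linarith) ?_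
  filter_upwards [(Finset.eventually_all _).mpr hcol, hH,
    (Filter.tendsto_add_atTop_nat 1).eventually hH] with n hn h1 h2
  have hstep : ∑ i ∈ Finset.range (h (n + 1) + 1), ‖etaCoeff α h (n + 1) i‖
      ≤ ∑ j ∈ Finset.range (H + 1), ‖etaCoeff α h n j‖ * ∑ i ∈ Finset.Icc j H,
        ‖seriesFactor α n j * seriesRatio h (n + 1) j i‖ := by
    simp only [Finset.mul_sum, sum_range_sum_Icc, h2]
    refine Finset.sum_le_sum fun i _ => ?_
    rw [etaCoeff, h1]
    refine (norm_sum_le _ _).trans (Finset.sum_le_sum fun j _ => ?_)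
    split_ifs
    · rw [norm_mul]
    · simp
  have hnn : ∀ n, 0 ≤ (∑ i ∈ Finset.range (h n + 1), ‖etaCoeff α h n i‖) * x ^ n := fun n => by
    positivity
  rw [Real.norm_of_nonneg (hnn _), Real.norm_of_nonneg (hnn _), h1]
  calc _ ≤ (∑ j ∈ Finset.range (H + 1), ‖etaCoeff α h n j‖ * ∑ i ∈ Finset.Icc j H,
        ‖seriesFactor α n j * seriesRatio h (n + 1) j i‖) * x ^ (n + 1) := by gcongr
    _ = ∑ j ∈ Finset.range (H + 1), ‖etaCoeff α h n j‖ * ((∑ i ∈ Finset.Icc j H,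
        ‖seriesFactor α n j * seriesRatio h (n + 1) j i‖) * x) * x ^ n := by
      rw [Finset.sum_mul]; exact Finset.sum_congr rfl fun j _ => by rw [pow_succ]; ring
    _ ≤ ∑ j ∈ Finset.range (H + 1), ‖etaCoeff α h n j‖ * ((x + 1) / 2) * x ^ n := by
      gcongr with j hj
      exact hn j hj
    _ = _ := by
      rw [Finset.sum_mul, Finset.mul_sum]; exact Finset.sum_congr rfl fun j _ => by ring

lemma summable_seriesTerm (ρ α : ℝ) {h : ℕ → ℕ} (hmono : Monotone h)
    (hb : BddAbove (Set.range h)) {ξ : ℂ} (hz : ‖zVar ρ ξ‖ < 1) :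
    Summable (seriesTerm ρ α h ξ) := by
  obtain ⟨H, hH⟩ := eventually_const_of_bddAbove hmono hb
  -- Once $h_n=H$, every power of $\eta$ that occurs is at most $\max(1,|\eta|)^H$ in absolute
  -- value.
  refine Summable.of_norm_bounded_eventually_nat
    ((summable_sum_norm_etaCoeff α hH (norm_nonneg _) hz).mul_left
      (max 1 ‖etaVar ρ ξ‖ ^ H)) ?_
  filter_upwards [hH] with n hn
  rw [seriesTerm, seriesCoeff_eq_sum, norm_mul, norm_pow, ← mul_assoc, Finset.mul_sum]
  gcongr
  refine (norm_sum_le _ _).trans (Finset.sum_le_sum fun i hi => ?_)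
  rw [norm_mul, norm_pow, mul_comm]
  gcongr
  calc ‖etaVar ρ ξ‖ ^ i ≤ max 1 ‖etaVar ρ ξ‖ ^ i := by gcongr; exact le_max_right _ _
    _ ≤ _ := pow_le_pow_right₀ (le_max_left _ _) (by rw [Finset.mem_range] at hi; omega)

lemma etaVar_ne_zero (ρ : ℝ) {ξ : ℂ} (hξ : ξ ≠ 0) : etaVar ρ ξ ≠ 0 := by
  refine mul_ne_zero ?_ hξ
  have : (1 + ρ ^ 2 : ℝ) ≠ 0 := by positivity
  exact_mod_cast this

lemma seriesTerm_eq_nested (ρ α : ℝ) {h : ℕ → ℕ} (hmono : Monotone h) (ξ : ℂ)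
    {r : ℕ → ℂ → ℝ → ℝ → ℝ} (hr : AdmissibleRadius r) {n : ℕ} (hn : 1 ≤ n) :
    seriesTerm ρ α h ξ n = nested r α h n (etaVar ρ ξ) * zVar ρ ξ ^ n := by
  rw [seriesTerm]
  rcases eq_or_ne ξ 0 with rfl | hξ
  -- At $\xi=0$ the factor $z^n$ vanishes on both sides, so the value of the nested integral at
  -- $\eta=0$ is not needed.
  · simp [zVar, Nat.one_le_iff_ne_zero.mp hn]
  · rw [seriesCoeff_eq_sum, nested_eq_sum r hr α h hmono n _ (etaVar_ne_zero ρ hξ)]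

end LameTypeTwo

end

theorem mainTheorem6 (ρ α : ℝ) (hρ₀ : 0 < ρ) (hρ₁ : ρ < 1)
    (h : ℕ → ℕ) (hmono : Monotone h) (ξ : ℂ)
    (r : ℕ → ℂ → ℝ → ℝ → ℝ) (hr : LameTypeTwo.AdmissibleRadius r) :
    (LameTypeTwo.seriesTerm ρ α h ξ 0 = LameTypeTwo.hyp h (LameTypeTwo.etaVar ρ ξ)) ∧
    (∀ n : ℕ, 1 ≤ n → LameTypeTwo.seriesTerm ρ α h ξ n =
      LameTypeTwo.nested r α h n (LameTypeTwo.etaVar ρ ξ) * LameTypeTwo.zVar ρ ξ ^ n) ∧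
    (Summable (LameTypeTwo.seriesTerm ρ α h ξ) ↔
      Summable (fun n : ℕ => LameTypeTwo.nested r α h (n + 1) (LameTypeTwo.etaVar ρ ξ) *
        LameTypeTwo.zVar ρ ξ ^ (n + 1))) ∧
    (Summable (LameTypeTwo.seriesTerm ρ α h ξ) →
      LameTypeTwo.LS ρ α h ξ = ξ ^ (1 / 2 : ℂ) *
        (LameTypeTwo.hyp h (LameTypeTwo.etaVar ρ ξ) +
          ∑' n : ℕ, LameTypeTwo.nested r α h (n + 1) (LameTypeTwo.etaVar ρ ξ) *
            LameTypeTwo.zVar ρ ξ ^ (n + 1))) ∧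
    (BddAbove (Set.range h) → ‖LameTypeTwo.zVar ρ ξ‖ < 1 →
      Summable (LameTypeTwo.seriesTerm ρ α h ξ)) := by
  have h0 : LameTypeTwo.seriesTerm ρ α h ξ 0 =
      LameTypeTwo.hyp h (LameTypeTwo.etaVar ρ ξ) := by
    rw [LameTypeTwo.seriesTerm, LameTypeTwo.seriesCoeff_eq_sum, LameTypeTwo.hyp_eq_sum α, pow_zero,
      mul_one]
  have hs : (fun n : ℕ => LameTypeTwo.nested r α h (n + 1) (LameTypeTwo.etaVar ρ ξ) *
      LameTypeTwo.zVar ρ ξ ^ (n + 1)) = fun n => LameTypeTwo.seriesTerm ρ α h ξ (n + 1) :=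
    funext fun n => (LameTypeTwo.seriesTerm_eq_nested ρ α hmono ξ hr (Nat.le_add_left 1 n)).symm
  refine ⟨h0, fun n hn => LameTypeTwo.seriesTerm_eq_nested ρ α hmono ξ hr hn, ?_, ?_,
    fun hb hz => LameTypeTwo.summable_seriesTerm ρ α hmono hb hz⟩
  · rw [hs, summable_nat_add_iff 1]
  · intro hsum
    rw [LameTypeTwo.LS, hsum.tsum_eq_zero_add, h0, ← hs]
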